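/- Let $d, n\in\mathbb N$ and let $\mathcal M_d$ be the algebra of complex $d\times d$ matrices. For $A\in\mathcal M_d$ let $W(A)=\{\langle Ax,x\rangle : x\in\mathbb C^d,\ \|x\|=1\}$ be the numerical range and $w(A)=\sup\{|\langle Ax,x\rangle| : x\in\mathbb C^d,\ \|x\|=1\}$ the numerical radius, and write $w^{1/2}(A)=(w(A))^{1/2}$. For $\gamma\in[0,\pi/2)$ write $A\in\Pi_\gamma$ if $W(A)\subseteq\{z\in\mathbb C : \operatorname{Re} z>0,\ |\operatorname{Im} z|\le(\tan\gamma)\operatorname{Re} z\}$. Call $A$ accretive-dissipative if $\frac{A+A^*}{2}$ and $\frac{A-A^*}{2i}$ are both positive definite. For $A\in\Pi_\gamma$ the square root is given by the Dunford–Taylor integral $A^{1/2}=\frac1{2\pi i}\int_\Gamma z^{1/2}(zI-A)^{-1}\,dz$, where $z^{1/2}$ is the principal branch and $\Gamma$ is a positively oriented circle that lies together with its interior in $\mathbb C\setminus(-\infty,0]$ and encloses all eigenvalues of $A$ (such circles exist). Let $\gamma\in[0,\pi/2)$ and $A_1,\dots,A_n\in\mathcal M_d$ with $A_i\in\Pi_\gamma$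 for $i=1,\dots,n$. Then $$w^{1/2}\Big(\sum_{i=1}^n A_i\Big)\le\sqrt{1+2\sin^2(\gamma/2)}\ \sum_{i=1}^n w\big(A_i^{1/2}\big).$$ Moreover, if each $A_i$ ($i=1,\dots,n$) is accretive-dissipative, then $$w^{1/2}\Big(\sum_{i=1}^n A_i\Big)\le\sqrt{1+\sin^2(\gamma/2)}\ \sum_{i=1}^n w\big(A_i^{1/2}\big).$$ -/

import Mathlib

open scoped ComplexStarModule ComplexOrder

namespace SectorialMatrix

noncomputable section

/-- The scalar `⟨A x, x⟩`, for the inner product of `ℂ^d` that is linear in its first argument;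
Mathlib's inner product is linear in the second argument, hence the order below. -/
def quadForm {d : ℕ} (A : Matrix (Fin d) (Fin d) ℂ) (x : EuclideanSpace ℂ (Fin d)) : ℂ :=
  inner ℂ x (Matrix.toEuclideanLin A x)

/-- The numerical range `W(A) = {⟨A x, x⟩ : ‖x‖ = 1}`. -/
def numericalRange {d : ℕ} (A : Matrix (Fin d) (Fin d) ℂ) : Set ℂ :=
  {z | ∃ x : EuclideanSpace ℂ (Fin d), ‖x‖ = 1 ∧ quadForm A x = z}

/-- The numerical radius `w(A) = sup {|⟨A x, x⟩| : ‖x‖ = 1}`. The set is bounded, and it is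
nonempty for `d ≥ 1`. -/
def numericalRadius {d : ℕ} (A : Matrix (Fin d) (Fin d) ℂ) : ℝ :=
  sSup {s : ℝ | ∃ x : EuclideanSpace ℂ (Fin d), ‖x‖ = 1 ∧ s = ‖quadForm A x‖}

/-- The sector `S_γ = {z : Re z > 0, |Im z| ≤ (tan γ) Re z}`. -/
def sector (γ : ℝ) : Set ℂ :=
  {z | 0 < z.re ∧ |z.im| ≤ Real.tan γ * z.re}

/-- The class `Π_γ` (used for `0 ≤ γ < π / 2`): matrices with `W(A) ⊆ S_γ`. -/
def IsSectorial {d : ℕ} (γ : ℝ) (A : Matrix (Fin d) (Fin d) ℂ) : Prop :=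
  numericalRange A ⊆ sector γ

/-- `A` is accretive-dissipative: both matrices of its Cartesian decomposition
`A = ℜ A + i ℑ A` are positive definite. -/
def IsAccretiveDissipative {d : ℕ} (A : Matrix (Fin d) (Fin d) ℂ) : Prop :=
  (ℜ A : Matrix (Fin d) (Fin d) ℂ).PosDef ∧ (ℑ A : Matrix (Fin d) (Fin d) ℂ).PosDef

/-- The circle with centre `p.1` and radius `p.2` lies, with its interior, in `ℂ \ (-∞, 0]` (the
domain of analyticity of the principal power functions) and encloses all eigenvalues of `A`. -/
def IsAdmissibleCircle {d : ℕ} (A : Matrix (Fin d) (Fin d) ℂ) (p : ℂ × ℝ) : Prop :=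
  0 < p.2 ∧ Metric.closedBall p.1 p.2 ⊆ Complex.slitPlane ∧ spectrum ℂ A ⊆ Metric.ball p.1 p.2

/-- The Dunford-Taylor integral `(2πi)⁻¹ ∮ f(z) (zI - A)⁻¹ dz` over the positively oriented circle
with centre `p.1` and radius `p.2`; the matrix-valued integral is taken entry by entry. -/
def dunfordTaylor {d : ℕ} (f : ℂ → ℂ) (A : Matrix (Fin d) (Fin d) ℂ) (p : ℂ × ℝ) :
    Matrix (Fin d) (Fin d) ℂ :=
  Matrix.of fun j k =>
    (2 * (Real.pi : ℂ) * Complex.I)⁻¹ *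
      ∮ z in C(p.1, p.2), f z * ((z • (1 : Matrix (Fin d) (Fin d) ℂ) - A)⁻¹) j k

open Classical in
/-- The fractional power `A^t = (2πi)⁻¹ ∮ z^t (zI - A)⁻¹ dz`, with the principal branch of `z^t`,
over an arbitrary admissible circle. Every sectorial matrix has such a circle, by
`exists_isAdmissibleCircle`. A matrix without one gets the placeholder value `0`. -/
def fracPow {d : ℕ} (A : Matrix (Fin d) (Fin d) ℂ) (t : ℝ) : Matrix (Fin d) (Fin d) ℂ :=
  if h : ∃ p : ℂ × ℝ, IsAdmissibleCircle A p then
    dunfordTaylor (fun z => z ^ (t : ℂ)) A h.choose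
  else 0

theorem spectrum_subset_numericalRange {d : ℕ} (A : Matrix (Fin d) (Fin d) ℂ) :
    spectrum ℂ A ⊆ numericalRange A := by
  intro l hl
  rw [← Matrix.spectrum_toLpLin 2, ← Module.End.hasEigenvalue_iff_mem_spectrum] at hl
  obtain ⟨v, hv⟩ := hl.exists_hasEigenvector
  have hv0 : (‖v‖ : ℂ) ≠ 0 := by simpa using hv.2
  refine ⟨((‖v‖ : ℂ)⁻¹) • v, ?_, ?_⟩
  · rw [norm_smul]
    simp [hv.2]
  · have h1 := hv.apply_eq_smul
    rw [quadForm, map_smul, h1, inner_smul_left, inner_smul_right, inner_smul_right,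
      inner_self_eq_norm_sq_to_K]
    simp
    field_simp

theorem exists_isAdmissibleCircle {d : ℕ} {γ : ℝ} {A : Matrix (Fin d) (Fin d) ℂ}
    (hA : IsSectorial γ A) : ∃ p : ℂ × ℝ, IsAdmissibleCircle A p := by
  have hpos : ∀ l ∈ spectrum ℂ A, 0 < l.re := fun l hl =>
    (hA (spectrum_subset_numericalRange A hl)).1
  have hfin : (spectrum ℂ A).Finite := Matrix.finite_spectrum A
  obtain ⟨R, hR⟩ := (hfin.image fun l : ℂ => ‖l‖ ^ 2 / (2 * l.re)).bddAbove
  have hR' : ∀ l ∈ spectrum ℂ A, ‖l - ((|R| + 1 : ℝ) : ℂ)‖ < |R| + 1 := by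
    intro l hl
    have h1 := hR (Set.mem_image_of_mem _ hl)
    have h2 := hpos l hl
    have h3 : ‖l‖ ^ 2 < (|R| + 1) * (2 * l.re) := by
      rw [← div_lt_iff₀ (by positivity)]
      have := le_abs_self R
      linarith
    refine lt_of_pow_lt_pow_left₀ 2 (by positivity) ?_
    rw [Complex.sq_norm, Complex.normSq_apply] at h3 ⊢
    simp only [Complex.sub_re, Complex.sub_im, Complex.ofReal_re, Complex.ofReal_im]
    nlinarith
  obtain ⟨r, hr0, hrR, hr⟩ : ∃ r : ℝ, 0 < r ∧ r < |R| + 1 ∧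
      ∀ l ∈ spectrum ℂ A, ‖l - ((|R| + 1 : ℝ) : ℂ)‖ < r := by
    have hev : ∀ᶠ r in nhdsWithin (|R| + 1) (Set.Iio (|R| + 1)),
        ∀ l ∈ spectrum ℂ A, ‖l - ((|R| + 1 : ℝ) : ℂ)‖ < r :=
      (Filter.eventually_all_finite hfin).2 fun l hl =>
        nhdsWithin_le_nhds (lt_mem_nhds (hR' l hl))
    have h0 : ∀ᶠ r in nhdsWithin (|R| + 1) (Set.Iio (|R| + 1)), 0 < r :=
      nhdsWithin_le_nhds (lt_mem_nhds (by positivity))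
    obtain ⟨r, ⟨h1, h2⟩, h3⟩ := ((hev.and h0).and self_mem_nhdsWithin).exists
    exact ⟨r, h2, h3, h1⟩
  refine ⟨(((|R| + 1 : ℝ) : ℂ), r), hr0, ?_, ?_⟩
  · intro z hz
    rw [Metric.mem_closedBall, dist_eq_norm] at hz
    refine Or.inl ?_
    have h1 := (abs_le.1 ((Complex.abs_re_le_norm _).trans hz)).1
    simp only [Complex.sub_re, Complex.ofReal_re] at h1
    linarith
  · intro l hl
    rw [Metric.mem_ball, dist_eq_norm]
    exact hr l hl

end

end SectorialMatrix

namespace SectorialMatrix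

theorem re_quadForm_sq_le {d : ℕ} (B : Matrix (Fin d) (Fin d) ℂ) {t : ℝ} (ht : 0 < t)
    (hB : ∀ x, ‖quadForm B x‖ ≤ t * ‖x‖ ^ 2) (x : EuclideanSpace ℂ (Fin d)) :
    (quadForm (B * B) x).re ≤ t ^ 2 * ‖x‖ ^ 2 := by
  set T := Matrix.toEuclideanLin B with hT
  have hBB : Matrix.toEuclideanLin (B * B) x = T (T x) := by
    simp [hT, Matrix.toLpLin_apply, Matrix.mulVec_mulVec]
  have key : ∀ y : EuclideanSpace ℂ (Fin d), |(inner ℂ y (T y)).re| ≤ t * (inner ℂ y y).re := by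
    intro y
    have h := (Complex.abs_re_le_norm _).trans (hB y)
    rwa [← inner_self_eq_norm_sq (𝕜 := ℂ)] at h
  have h1 := (abs_le.1 (key ((t : ℂ) • x + T x))).2
  have h2 := (abs_le.1 (key ((t : ℂ) • x - T x))).1
  rw [quadForm, hBB, ← inner_self_eq_norm_sq (𝕜 := ℂ)]
  simp only [map_add, map_sub, map_smul, inner_add_left, inner_add_right, inner_sub_left,
    inner_sub_right, inner_smul_left, inner_smul_right, Complex.conj_ofReal, Complex.add_re,
    Complex.sub_re, Complex.re_ofReal_mul] at h1 h2
  have h3 : 4 * t * (inner ℂ x (T (T x))).re ≤ 4 * t * (t ^ 2 * (inner ℂ x x).re) := by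
    linarith
  exact le_of_mul_le_mul_left h3 (by positivity)

theorem quadForm_smul {d : ℕ} (a : ℂ) (A : Matrix (Fin d) (Fin d) ℂ)
    (x : EuclideanSpace ℂ (Fin d)) : quadForm (a • A) x = a * quadForm A x := by
  simp [quadForm]

theorem norm_quadForm_sq_le {d : ℕ} (B : Matrix (Fin d) (Fin d) ℂ) {t : ℝ} (ht : 0 < t)
    (hB : ∀ x, ‖quadForm B x‖ ≤ t * ‖x‖ ^ 2) (x : EuclideanSpace ℂ (Fin d)) :
    ‖quadForm (B * B) x‖ ≤ t ^ 2 * ‖x‖ ^ 2 := by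
  obtain ⟨u, hu, hq⟩ : ∃ u : ℂ, ‖u‖ = 1 ∧ u ^ 2 * quadForm (B * B) x = ‖quadForm (B * B) x‖ := by
    refine ⟨Complex.exp (((-(quadForm (B * B) x).arg / 2 : ℝ) : ℂ) * Complex.I),
      Complex.norm_exp_ofReal_mul_I _, ?_⟩
    nth_rewrite 2 [← Complex.norm_mul_exp_arg_mul_I (quadForm (B * B) x)]
    rw [← Complex.exp_nat_mul, mul_left_comm, ← Complex.exp_add]
    push_cast
    ring_nf
    simp
  have h := re_quadForm_sq_le (u • B) ht (fun y => by
    rw [quadForm_smul, norm_mul, hu, one_mul]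
    exact hB y) x
  rw [smul_mul_smul_comm, quadForm_smul, ← sq, hq, Complex.ofReal_re] at h
  exact h

theorem bddAbove_norm_quadForm {d : ℕ} (A : Matrix (Fin d) (Fin d) ℂ) :
    BddAbove {s : ℝ | ∃ x : EuclideanSpace ℂ (Fin d), ‖x‖ = 1 ∧ s = ‖quadForm A x‖} := by
  refine ⟨‖LinearMap.toContinuousLinearMap (Matrix.toEuclideanLin A)‖, ?_⟩
  rintro s ⟨x, hx, rfl⟩
  have h := (LinearMap.toContinuousLinearMap (Matrix.toEuclideanLin A)).le_opNorm x
  refine (norm_inner_le_norm _ _).trans ?_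
  simpa [hx] using h

theorem numericalRadius_nonneg {d : ℕ} (A : Matrix (Fin d) (Fin d) ℂ) : 0 ≤ numericalRadius A :=
  Real.sSup_nonneg (by rintro s ⟨x, -, rfl⟩; exact norm_nonneg _)

theorem norm_quadForm_le_of_norm_eq_one {d : ℕ} (A : Matrix (Fin d) (Fin d) ℂ)
    {x : EuclideanSpace ℂ (Fin d)} (hx : ‖x‖ = 1) : ‖quadForm A x‖ ≤ numericalRadius A :=
  le_csSup (bddAbove_norm_quadForm A) ⟨x, hx, rfl⟩

theorem norm_quadForm_le {d : ℕ} (A : Matrix (Fin d) (Fin d) ℂ)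
    (x : EuclideanSpace ℂ (Fin d)) : ‖quadForm A x‖ ≤ numericalRadius A * ‖x‖ ^ 2 := by
  rcases eq_or_ne x 0 with rfl | hx
  · simp [quadForm]
  have hx0 : 0 < ‖x‖ := norm_pos_iff.2 hx
  have h := norm_quadForm_le_of_norm_eq_one A (x := ((‖x‖⁻¹ : ℝ) : ℂ) • x)
    (by rw [norm_smul]; simp [hx0.ne'])
  rw [quadForm, map_smul, inner_smul_left, inner_smul_right, ← mul_assoc, norm_mul] at h
  rw [← div_le_iff₀ (by positivity)]
  refine le_trans (le_of_eq ?_) h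
  rw [quadForm]
  simp
  field_simp

theorem numericalRadius_le {d : ℕ} {A : Matrix (Fin d) (Fin d) ℂ} {c : ℝ} (hc : 0 ≤ c)
    (h : ∀ x : EuclideanSpace ℂ (Fin d), ‖x‖ = 1 → ‖quadForm A x‖ ≤ c) :
    numericalRadius A ≤ c :=
  Real.sSup_le (by rintro s ⟨x, hx, rfl⟩; exact h x hx) hc

/-- The power inequality for the numerical radius, for squares. -/
theorem numericalRadius_mul_self_le {d : ℕ} (B : Matrix (Fin d) (Fin d) ℂ) :
    numericalRadius (B * B) ≤ numericalRadius B ^ 2 := by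
  refine numericalRadius_le (by positivity) fun x hx => ?_
  have hlim : Filter.Tendsto (fun t : ℝ => t ^ 2)
      (nhdsWithin (numericalRadius B) (Set.Ioi (numericalRadius B)))
      (nhds (numericalRadius B ^ 2)) :=
    ((continuous_pow 2).tendsto _).mono_left nhdsWithin_le_nhds
  refine ge_of_tendsto hlim ?_
  filter_upwards [self_mem_nhdsWithin] with t ht
  have ht0 : 0 < t := (numericalRadius_nonneg B).trans_lt ht
  have h := norm_quadForm_sq_le B ht0 (fun y => (norm_quadForm_le B y).trans (by
    gcongr
    exact le_of_lt ht)) x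
  simpa [hx] using h

theorem numericalRadius_sum_le {d n : ℕ} (A : Fin n → Matrix (Fin d) (Fin d) ℂ) :
    numericalRadius (∑ i, A i) ≤ ∑ i, numericalRadius (A i) := by
  refine numericalRadius_le (Finset.sum_nonneg fun i _ => numericalRadius_nonneg _) fun x hx => ?_
  have h : quadForm (∑ i, A i) x = ∑ i, quadForm (A i) x := by
    simp [quadForm]
  rw [h]
  exact (norm_sum_le _ _).trans
    (Finset.sum_le_sum fun i _ => norm_quadForm_le_of_norm_eq_one _ hx)

theorem summable_norm_pow_mul_inv_pow {𝔸 : Type*} [NormedRing 𝔸] [NormedAlgebra ℂ 𝔸]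
    [CompleteSpace 𝔸] [Nontrivial 𝔸] {a : 𝔸} {r : ℝ} (hr : 0 < r)
    (ha : spectrum ℂ a ⊆ Metric.ball 0 r) : Summable fun n => ‖a ^ n‖ * r⁻¹ ^ n := by
  lift r to NNReal using hr.le
  have h1 : spectralRadius ℂ a < r := spectrum.spectralRadius_lt_of_forall_lt _ fun z hz => by
    have := ha hz
    rw [mem_ball_zero_iff] at this
    exact_mod_cast this
  obtain ⟨s, hs1, hs2⟩ := ENNReal.lt_iff_exists_nnreal_btwn.1 h1
  have hs2' : (s : ℝ) < r := by exact_mod_cast hs2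
  have h2 : ∀ᶠ n : ℕ in Filter.atTop, ‖a ^ n‖ * ((r : ℝ)⁻¹) ^ n ≤ (s / r : ℝ) ^ n := by
    filter_upwards [(spectrum.pow_nnnorm_pow_one_div_tendsto_nhds_spectralRadius a).eventually
      (gt_mem_nhds hs1), Filter.eventually_gt_atTop 0] with n hn hn0
    have h3 := ENNReal.rpow_le_rpow hn.le (Nat.cast_nonneg n : (0 : ℝ) ≤ n)
    rw [← ENNReal.rpow_mul, one_div_mul_cancel (by positivity), ENNReal.rpow_one,
      ENNReal.rpow_natCast] at h3
    have h4 : ‖a ^ n‖ ≤ (s : ℝ) ^ n := by exact_mod_cast h3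
    rw [div_pow, div_eq_mul_inv, inv_pow]
    gcongr
  refine Summable.of_norm_bounded_eventually_nat
    (summable_geometric_of_lt_one (by positivity) ((div_lt_one hr).2 hs2')) ?_
  filter_upwards [h2] with n hn
  rwa [Real.norm_of_nonneg (by positivity)]

theorem hasSum_circleIntegral_mul {f g : ℂ → ℂ} {c : ℂ} {r : ℝ} (hr : 0 < r)
    (hf : CircleIntegrable f c r) {u : ℕ → ℂ} (hu : Summable fun n => ‖u n‖ * r⁻¹ ^ n)
    (hg : ∀ z ∈ Metric.sphere c r, HasSum (fun n => (z - c)⁻¹ ^ (n + 1) * u n) (g z)) :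
    HasSum (fun n => (∮ z in C(c, r), f z * (z - c)⁻¹ ^ (n + 1)) * u n)
      (∮ z in C(c, r), f z * g z) := by
  have h : HasSum (fun n => ∮ z in C(c, r), f z * (z - c)⁻¹ ^ (n + 1) * u n)
      (∮ z in C(c, r), f z * g z) := by
    refine intervalIntegral.hasSum_integral_of_dominated_convergence
      (fun n θ => ‖f (circleMap c r θ)‖ * (‖u n‖ * r⁻¹ ^ n)) (fun n => ?_) (fun n => ?_) ?_ ?_ ?_
    · simp only [deriv_circleMap]
      have h1 : Measurable fun θ => circleMap 0 r θ * Complex.I := by fun_prop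
      have h2 : Measurable fun θ => (circleMap c r θ - c)⁻¹ ^ (n + 1) :=
        Measurable.pow_const (by fun_prop) _
      exact h1.aestronglyMeasurable.smul
        ((hf.def'.1.mul h2.aestronglyMeasurable).mul_const _)
    · refine Filter.Eventually.of_forall fun θ _ => le_of_eq ?_
      simp [abs_of_pos hr, pow_succ]
      field_simp
    · exact Filter.Eventually.of_forall fun θ _ => hu.mul_left _
    · simp only [tsum_mul_left]
      exact hf.norm.mul_continuousOn continuousOn_const
    · refine Filter.Eventually.of_forall fun θ _ => HasSum.const_smul _ ?_
      simp only [mul_assoc]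
      exact (hg _ (circleMap_mem_sphere _ hr.le _)).mul_left _
  convert! h using 2 with n
  simp only [mul_comm _ (u n)]
  exact (circleIntegral.integral_const_mul _ _ _ _).symm

/-- The Taylor coefficients of `f` at `c`, as Cauchy integrals over a circle of radius `r`. -/
noncomputable def cauchyCoeff (f : ℂ → ℂ) (c : ℂ) (r : ℝ) (n : ℕ) : ℂ :=
  (2 * (Real.pi : ℂ) * Complex.I)⁻¹ * ∮ z in C(c, r), f z * (z - c)⁻¹ ^ (n + 1)

theorem exists_norm_cauchyCoeff_le {f : ℂ → ℂ} {c : ℂ} {r : ℝ} (hr : 0 < r)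
    (hf : ContinuousOn f (Metric.sphere c r)) :
    ∃ C, ∀ n, ‖cauchyCoeff f c r n‖ ≤ C * r⁻¹ ^ n := by
  obtain ⟨C, hC⟩ := (isCompact_sphere c r).exists_bound_of_continuousOn hf
  refine ⟨C, fun n => ?_⟩
  have h := circleIntegral.norm_two_pi_i_inv_smul_integral_le_of_norm_le_const (c := c) hr.le
    (f := fun z => f z * (z - c)⁻¹ ^ (n + 1)) (C := C * r⁻¹ ^ (n + 1)) fun z hz => by
      rw [norm_mul, norm_pow, norm_inv, mem_sphere_iff_norm.1 hz]
      gcongr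
      exact hC z hz
  refine h.trans (le_of_eq ?_)
  rw [pow_succ]
  field_simp

theorem hasSum_cauchyCoeff {f : ℂ → ℂ} {c : ℂ} {r : ℝ} (hr : 0 < r)
    (hf : DiffContOnCl ℂ f (Metric.ball c r)) {w : ℂ} (hw : ‖w‖ < r) :
    HasSum (fun n => cauchyCoeff f c r n * w ^ n) (f (c + w)) := by
  have hint : CircleIntegrable f c r :=
    (hf.continuousOn_ball.mono Metric.sphere_subset_closedBall).circleIntegrable hr.le
  have hlt : ‖w‖ * r⁻¹ < 1 := by rwa [← div_eq_mul_inv, div_lt_one hr]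
  have h := hasSum_circleIntegral_mul hr hint (u := fun n => w ^ n)
    (g := fun z => (z - (c + w))⁻¹) (by
      simp only [norm_pow, ← mul_pow]
      exact summable_geometric_of_lt_one (by positivity) hlt) fun z hz => by
      have hz' : ‖(z - c)⁻¹ * w‖ < 1 := by
        rwa [norm_mul, norm_inv, mem_sphere_iff_norm.1 hz, mul_comm]
      have hzc : z - c ≠ 0 := by
        rw [← norm_ne_zero_iff, mem_sphere_iff_norm.1 hz]
        exact hr.ne'
      convert! (hasSum_geometric_of_norm_lt_one hz').mul_left (z - c)⁻¹ using 1
      · ext n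
        ring
      · rw [← mul_inv, mul_sub, mul_inv_cancel_left₀ hzc, mul_one, sub_sub]
  have h2 := hf.two_pi_i_inv_smul_circleIntegral_sub_inv_smul
    (w := c + w) (by simpa using hw)
  rw [← h2]
  convert! h.mul_left (2 * (Real.pi : ℂ) * Complex.I)⁻¹ using 2 with n
  · rw [cauchyCoeff, mul_assoc]
  · simp only [smul_eq_mul, mul_comm]

theorem eq_of_hasSum_mul_pow {a b : ℕ → ℂ} {g : ℂ → ℂ} {r : ℝ} (hr : 0 < r)
    (ha : ∀ w : ℂ, ‖w‖ < r → HasSum (fun n => a n * w ^ n) (g w))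
    (hb : ∀ w : ℂ, ‖w‖ < r → HasSum (fun n => b n * w ^ n) (g w)) : a = b := by
  have key : ∀ a : ℕ → ℂ, (∀ w : ℂ, ‖w‖ < r → HasSum (fun n => a n * w ^ n) (g w)) →
      HasFPowerSeriesAt g (FormalMultilinearSeries.ofScalars ℂ a) 0 := by
    intro a ha
    rw [hasFPowerSeriesAt_iff]
    filter_upwards [Metric.ball_mem_nhds (0 : ℂ) hr] with w hw
    simpa [FormalMultilinearSeries.coeff_ofScalars, mul_comm] using
      ha w (mem_ball_zero_iff.1 hw)
  have h := (key a ha).eq_formalMultilinearSeries (key b hb)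
  ext n
  have := congrArg (fun p => FormalMultilinearSeries.coeff p n) h
  simpa [FormalMultilinearSeries.coeff_ofScalars] using this

/-- The product of the Taylor series of a square root of the identity with itself. -/
theorem sum_antidiagonal_cauchyCoeff {f : ℂ → ℂ} {c : ℂ} {r : ℝ} (hr : 0 < r)
    (hf : DiffContOnCl ℂ f (Metric.ball c r)) (hff : ∀ z ∈ Metric.ball c r, f z * f z = z) :
    (fun n => ∑ p ∈ Finset.HasAntidiagonal.antidiagonal n, cauchyCoeff f c r p.1 * cauchyCoeff f c r p.2) =
      fun n => if n = 0 then c else if n = 1 then 1 else 0 := by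
  refine eq_of_hasSum_mul_pow hr (g := fun w => c + w) (fun w hw => ?_) (fun w hw => ?_)
  · have h := hasSum_cauchyCoeff hr hf hw
    have hs := h.summable.norm
    have h2 := tsum_mul_tsum_eq_tsum_sum_antidiagonal_of_summable_norm hs hs
    rw [h.tsum_eq, hff _ (by simpa using hw)] at h2
    have h3 := (summable_norm_sum_mul_antidiagonal_of_summable_norm hs hs).of_norm.hasSum
    rw [← h2] at h3
    convert! h3 using 2 with n
    rw [Finset.sum_mul]
    refine Finset.sum_congr rfl fun p hp => ?_
    rw [← Finset.HasAntidiagonal.mem_antidiagonal.1 hp]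
    ring
  · have h := hasSum_sum_of_ne_finset_zero (s := Finset.range 2) (f := fun n : ℕ =>
      (if n = 0 then c else if n = 1 then 1 else 0) * w ^ n)
      (L := SummationFilter.unconditional ℕ) fun n hn => by
        have : n ≠ 0 ∧ n ≠ 1 := by
          rw [Finset.mem_range] at hn
          omega
        simp [this]
    simpa [Finset.sum_range_succ] using h

attribute [local instance] Matrix.linftyOpNormedRing Matrix.linftyOpNormedAlgebra

theorem dunfordTaylor_mul_self {d : ℕ} {A : Matrix (Fin d) (Fin d) ℂ} {c : ℂ} {r : ℝ}
    (hr : 0 < r) (hA : spectrum ℂ A ⊆ Metric.ball c r) {f : ℂ → ℂ}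
    (hf : DiffContOnCl ℂ f (Metric.ball c r)) (hff : ∀ z ∈ Metric.ball c r, f z * f z = z) :
    dunfordTaylor f A (c, r) * dunfordTaylor f A (c, r) = A := by
  rcases isEmpty_or_nonempty (Fin d) with hd | hd
  · exact Subsingleton.elim _ _
  have hfs : ContinuousOn f (Metric.sphere c r) :=
    hf.continuousOn_ball.mono Metric.sphere_subset_closedBall
  set X : Matrix (Fin d) (Fin d) ℂ := A - algebraMap ℂ _ c with hX
  have hAX : A = algebraMap ℂ _ c + X := by rw [hX]; abel
  have hXs : spectrum ℂ X ⊆ Metric.ball 0 r := by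
    intro z hz
    have h := hA (hAX ▸ spectrum.add_mem_add_iff.2 hz : z + c ∈ spectrum ℂ A)
    simpa using h
  have hsum := summable_norm_pow_mul_inv_pow hr hXs
  have hres : ∀ z ∈ Metric.sphere c r, HasSum (fun n => (z - c)⁻¹ ^ (n + 1) • X ^ n)
      (z • (1 : Matrix (Fin d) (Fin d) ℂ) - A)⁻¹ := by
    intro z hz
    have hzn : ‖z - c‖ = r := mem_sphere_iff_norm.1 hz
    have hzc : z - c ≠ 0 := by
      rw [← norm_ne_zero_iff, hzn]
      exact hr.ne'
    have hs : Summable (((z - c)⁻¹ • X) ^ · : ℕ → Matrix (Fin d) (Fin d) ℂ) := by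
      refine Summable.of_norm ?_
      convert! hsum using 2 with n
      rw [smul_pow, norm_smul, norm_pow, norm_inv, hzn, mul_comm]
    have h1 := hs.one_sub_mul_tsum_pow
    have h2 : (z • (1 : Matrix (Fin d) (Fin d) ℂ) - A)⁻¹ =
        (z - c)⁻¹ • ∑' n : ℕ, ((z - c)⁻¹ • X) ^ n := by
      refine Matrix.inv_eq_right_inv ?_
      have h3 : z • (1 : Matrix (Fin d) (Fin d) ℂ) - A = (z - c) • (1 - (z - c)⁻¹ • X) := by
        rw [smul_sub, smul_inv_smul₀ hzc, hX, Algebra.algebraMap_eq_smul_one, sub_smul]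
        abel
      rw [h3, smul_mul_smul_comm, h1, mul_inv_cancel₀ hzc, one_smul]
    rw [h2]
    convert! hs.hasSum.const_smul (z - c)⁻¹ using 2 with n
    rw [smul_pow, smul_smul, pow_succ']
  set a := cauchyCoeff f c r with ha
  have hsa : Summable fun n => ‖a n • X ^ n‖ := by
    obtain ⟨C, hC⟩ := exists_norm_cauchyCoeff_le hr hfs
    refine Summable.of_nonneg_of_le (fun _ => norm_nonneg _) (fun n => ?_) (hsum.mul_left C)
    rw [norm_smul]
    calc ‖a n‖ * ‖X ^ n‖ ≤ C * r⁻¹ ^ n * ‖X ^ n‖ := by gcongr; exact hC n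
      _ = C * (‖X ^ n‖ * r⁻¹ ^ n) := by ring
  have hentry : ∀ j k, Continuous fun M : Matrix (Fin d) (Fin d) ℂ => M j k :=
    fun j k => continuous_id.matrix_elem j k
  have hF : dunfordTaylor f A (c, r) = ∑' n, a n • X ^ n := by
    ext j k
    have hu : Summable fun n => ‖(X ^ n) j k‖ * r⁻¹ ^ n := by
      have h1 : Summable fun n => ((r : ℂ)⁻¹ ^ n • X ^ n) := by
        refine Summable.of_norm ?_
        convert! hsum using 2 with n
        rw [norm_smul, norm_pow, norm_inv, Complex.norm_real, Real.norm_of_nonneg hr.le, mul_comm]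
      have h2 := (h1.map (Matrix.entryAddMonoidHom ℂ j k) (hentry j k)).norm
      convert! h2 using 2 with n
      simp [abs_of_pos hr, mul_comm]
    have h := hasSum_circleIntegral_mul hr (hfs.circleIntegrable hr.le) hu
      (g := fun z => ((z • (1 : Matrix (Fin d) (Fin d) ℂ) - A)⁻¹) j k)
      fun z hz => (hres z hz).map (Matrix.entryAddMonoidHom ℂ j k) (hentry j k)
    have h3 := hsa.of_norm.hasSum.map (Matrix.entryAddMonoidHom ℂ j k) (hentry j k)
    refine HasSum.unique ?_ h3
    convert! h.mul_left (2 * (Real.pi : ℂ) * Complex.I)⁻¹ using 2 with n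
    simp [ha, cauchyCoeff, mul_assoc]
  rw [hF]
  refine (tsum_mul_tsum_eq_tsum_sum_antidiagonal_of_summable_norm hsa hsa).trans ?_
  have hco : ∀ n, ∑ p ∈ Finset.HasAntidiagonal.antidiagonal n, a p.1 • X ^ p.1 * a p.2 • X ^ p.2 =
      (if n = 0 then c else if n = 1 then 1 else 0) • X ^ n := by
    intro n
    rw [← congrFun (sum_antidiagonal_cauchyCoeff hr hf hff) n, Finset.sum_smul]
    refine Finset.sum_congr rfl fun p hp => ?_
    rw [smul_mul_smul_comm, ← pow_add, Finset.HasAntidiagonal.mem_antidiagonal.1 hp]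
  simp only [hco]
  rw [tsum_eq_sum (s := Finset.range 2)]
  · refine Eq.trans ?_ hAX.symm
    simp [Finset.sum_range_succ, Algebra.algebraMap_eq_smul_one]
  · intro n hn
    have : n ≠ 0 ∧ n ≠ 1 := by
      rw [Finset.mem_range] at hn
      omega
    simp [this]

theorem diffContOnCl_cpow_of_closedBall_subset_slitPlane {c : ℂ} {r : ℝ} (s : ℂ)
    (h : Metric.closedBall c r ⊆ Complex.slitPlane) :
    DiffContOnCl ℂ (fun z => z ^ s) (Metric.ball c r) := by
  refine DifferentiableOn.diffContOnCl_ball (U := Complex.slitPlane) ?_ h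
  exact fun z hz => ((differentiableAt_id).cpow_const hz).differentiableWithinAt

theorem fracPow_half_mul_self {d : ℕ} {γ : ℝ} {A : Matrix (Fin d) (Fin d) ℂ}
    (hA : IsSectorial γ A) : fracPow A (1 / 2) * fracPow A (1 / 2) = A := by
  have h := exists_isAdmissibleCircle hA
  rw [fracPow, dif_pos h]
  obtain ⟨hr, hball, hspec⟩ := h.choose_spec
  refine dunfordTaylor_mul_self hr hspec
    (diffContOnCl_cpow_of_closedBall_subset_slitPlane _ hball) fun z hz => ?_
  rw [← Complex.cpow_add _ _ (Complex.slitPlane_ne_zero (hball (Metric.ball_subset_closedBall hz)))]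
  norm_num

theorem rpow_half_numericalRadius_sum_le {d n : ℕ} {γ : ℝ}
    (A : Fin n → Matrix (Fin d) (Fin d) ℂ) (hA : ∀ i, IsSectorial γ (A i)) :
    numericalRadius (∑ i, A i) ^ (1 / 2 : ℝ) ≤ ∑ i, numericalRadius (fracPow (A i) (1 / 2)) := by
  have h0 : ∀ i ∈ Finset.univ, 0 ≤ numericalRadius (fracPow (A i) (1 / 2)) :=
    fun i _ => numericalRadius_nonneg _
  rw [← Real.sqrt_eq_rpow]
  refine Real.sqrt_le_iff.2 ⟨Finset.sum_nonneg h0, ?_⟩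
  calc numericalRadius (∑ i, A i) ≤ ∑ i, numericalRadius (A i) := numericalRadius_sum_le A
    _ ≤ ∑ i, numericalRadius (fracPow (A i) (1 / 2)) ^ 2 := Finset.sum_le_sum fun i _ => by
      conv_lhs => rw [← fracPow_half_mul_self (hA i)]
      exact numericalRadius_mul_self_le _
    _ ≤ (∑ i, numericalRadius (fracPow (A i) (1 / 2))) ^ 2 := Finset.sum_sq_le_sq_sum_of_nonneg h0

end SectorialMatrix

theorem corollary2p9 {d n : ℕ} (γ : ℝ) (hγ0 : 0 ≤ γ) (hγ : γ < Real.pi / 2)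
    (A : Fin n → Matrix (Fin d) (Fin d) ℂ)
    (hA : ∀ i, SectorialMatrix.IsSectorial γ (A i)) :
    SectorialMatrix.numericalRadius (∑ i, A i) ^ (1 / 2 : ℝ) ≤
        Real.sqrt (1 + 2 * Real.sin (γ / 2) ^ 2) *
          ∑ i, SectorialMatrix.numericalRadius (SectorialMatrix.fracPow (A i) (1 / 2)) ∧
      ((∀ i, SectorialMatrix.IsAccretiveDissipative (A i)) →
        SectorialMatrix.numericalRadius (∑ i, A i) ^ (1 / 2 : ℝ) ≤
          Real.sqrt (1 + Real.sin (γ / 2) ^ 2) *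
            ∑ i, SectorialMatrix.numericalRadius (SectorialMatrix.fracPow (A i) (1 / 2))) := by
  have h := SectorialMatrix.rpow_half_numericalRadius_sum_le A hA
  have h0 : 0 ≤ ∑ i, SectorialMatrix.numericalRadius (SectorialMatrix.fracPow (A i) (1 / 2)) :=
    Finset.sum_nonneg fun i _ => SectorialMatrix.numericalRadius_nonneg _
  have h1 := sq_nonneg (Real.sin (γ / 2))
  exact ⟨h.trans (le_mul_of_one_le_left h0 (Real.one_le_sqrt.2 (by linarith))),
    fun _ => h.trans (le_mul_of_one_le_left h0 (Real.one_le_sqrt.2 (by linarith)))⟩
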